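/- For a finite simple graph $G$ with adjacency matrix $A(G)$ and diagonal matrix of vertex degrees $D(G)$, and for $\alpha\in[0,1]$, let $A_\alpha(G)=\alpha D(G)+(1-\alpha)A(G)$, and let the $A_\alpha$-spectrum of $G$ be the multiset of eigenvalues of $A_\alpha(G)$, regarded as a function of the parameter $\alpha\in[0,1]$. For integers $p,q\ge 2$ and $n\ge 2$, let $H(p,n,q)$ be the double starlike tree obtained from the path $P_n$ on $n$ vertices by attaching $p$ pendant vertices to one end vertex of $P_n$ and $q$ pendant vertices to the other end vertex. Then $H(p,n,q)$ is determined by its $A_\alpha$-spectrum: if $G'$ is any finite simple graph such that, for every $\alpha\in[0,1]$, the matrices $A_\alpha(G')$ and $A_\alpha(H(p,n,q))$ have the same eigenvalues with the same multiplicities, then $G'$ is isomorphic to $H(p,n,q)$. -/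

import Mathlib

open scoped Classical in
/-- The matrix `A_α(G) = α D(G) + (1 - α) A(G)`, where `D(G)` is the diagonal matrix of vertex
degrees and `A(G)` is the adjacency matrix of the finite simple graph `G`. -/
noncomputable def SimpleGraph.aAlphaMatrix {V : Type*} [Fintype V] (G : SimpleGraph V) (α : ℝ) :
    Matrix V V ℝ :=
  α • G.degMatrix ℝ + (1 - α) • G.adjMatrix ℝ

open scoped Classical in
/-- The `A_α`-characteristic polynomial `det (x I - A_α(G))` at a given `α`. -/
noncomputable def SimpleGraph.aAlphaCharpoly {V : Type*} [Fintype V] (G : SimpleGraph V) (α : ℝ) :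
    Polynomial ℝ :=
  (G.aAlphaMatrix α).charpoly

/-- The `A_α`-spectrum of `G` at a given `α`: the multiset of roots, with multiplicities, of its
`A_α`-characteristic polynomial. Since `A_α(G)` is a real symmetric matrix, these are all of its
eigenvalues. -/
noncomputable def SimpleGraph.aAlphaSpectrum {V : Type*} [Fintype V] (G : SimpleGraph V) (α : ℝ) :
    Multiset ℝ :=
  (G.aAlphaCharpoly α).roots

/-- Two finite graphs are `A_α`-cospectral if they have the same `A_α`-spectrum. Here `α` is a
parameter that runs through the whole interval `[0, 1]`: the `A_α`-spectrum is the family of the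
spectra of the matrices `A_α(G)`, and cospectrality is equality of these families. -/
def SimpleGraph.AAlphaCospectral {V W : Type*} [Fintype V] [Fintype W]
    (G : SimpleGraph V) (H : SimpleGraph W) : Prop :=
  ∀ α : ℝ, α ∈ Set.Icc (0 : ℝ) 1 → G.aAlphaSpectrum α = H.aAlphaSpectrum α

/-- `G` is determined by its `A_α`-spectrum: every finite simple graph (on any vertex set, with
any number of vertices, connected or not) that is `A_α`-cospectral with `G` is isomorphic
to `G`. -/
def SimpleGraph.IsDeterminedByAAlphaSpectrum.{u, v} {V : Type u} [Fintype V]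
    (G : SimpleGraph V) : Prop :=
  ∀ (W : Type v) [Fintype W] (G' : SimpleGraph W),
    G.AAlphaCospectral G' → Nonempty (G ≃g G')

/-- The graph `H(p, n, q)`: the path on the vertices `0, …, n - 1`, with `p` pendant vertices
attached to its end `0` and `q` pendant vertices attached to its end `n - 1`. -/
def doubleStarlikeTree (p n q : ℕ) : SimpleGraph (Fin n ⊕ (Fin p ⊕ Fin q)) where
  Adj
    | .inl i, .inl j => (SimpleGraph.pathGraph n).Adj i j
    | .inl i, .inr (.inl _) => i.val = 0
    | .inr (.inl _), .inl i => i.val = 0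
    | .inl i, .inr (.inr _) => i.val + 1 = n
    | .inr (.inr _), .inl i => i.val + 1 = n
    | .inr _, .inr _ => False
  symm := ⟨by
    rintro (i | i | i) (j | j | j) h
    · exact SimpleGraph.Adj.symm h
    all_goals exact h⟩
  loopless := ⟨by
    rintro (i | i | i) h
    · exact (SimpleGraph.pathGraph n).irrefl h
    all_goals exact h⟩

/-! The matrices `A_α` are multiples of `D + tA` with `t = (1 - α)/α`, so the spectra determine
det(x - D - tA) for all real x and t (`AAlphaCospectral.det_eq`). Three consequences are used. The
value α = 1 gives the degree multiset. The value t = -1 gives the Laplacian spectrum, hence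
connectedness. The t²-coefficient gives Σ 1/((x - d_u)(x - d_v)) over adjacent pairs, whose residue
at x = 1 is 2 Σ l(v)/(1 - d_v), with l(v) the number of leaves at v. Together they fix Σ (d_v - 2)(1
- l(v)/(d_v - 1)) over d_v ≥ 2. Its terms are nonnegative, and it is 0 for H(p,n,q). So in G' each
vertex of degree at least 3 has exactly one nonleaf neighbour
(`AAlphaCospectral.leafDegree_add_one_eq`). A path joining the vertices of degrees p+1 and q+1, with
their leaves, is then all of G' (`exists_iso_of_connected`). -/

/-! ### Determinants of linear pencils and their low-order coefficients. -/

open Matrix in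
lemma Matrix.exists_polynomial_eval_det_add_smul {n R : Type*} [Fintype n] [DecidableEq n]
    [CommRing R] (B C : Matrix n n R) :
    ∃ P : Polynomial R, ∀ t, P.eval t = (B + t • C).det := by
  refine ⟨(B.map Polynomial.C + (Polynomial.X : Polynomial R) • C.map Polynomial.C).det,
    fun t => ?_⟩
  rw [← Polynomial.coe_evalRingHom, RingHom.map_det]
  congr 1
  ext i j
  simp [mul_comm t]

open Matrix in
/-- If `det (B + t C) = det (B' + t C')` for infinitely many `t`, then it holds for all `t`. -/
lemma Matrix.det_add_smul_eq_of_infinite {n m K : Type*} [Fintype n] [DecidableEq n] [Fintype m]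
    [DecidableEq m] [Field K] (B C : Matrix n n K) (B' C' : Matrix m m K) {s : Set K}
    (hs : s.Infinite) (h : ∀ t ∈ s, (B + t • C).det = (B' + t • C').det) (t : K) :
    (B + t • C).det = (B' + t • C').det := by
  obtain ⟨P, hP⟩ := exists_polynomial_eval_det_add_smul B C
  obtain ⟨Q, hQ⟩ := exists_polynomial_eval_det_add_smul B' C'
  have : P = Q := Polynomial.eq_of_infinite_eval_eq _ _
    (hs.mono fun t ht => by simp [hP, hQ, h t ht])
  rw [← hP, ← hQ, this]

open Matrix in
lemma Matrix.eval_det_one_add_X_smul {n R : Type*} [Fintype n] [DecidableEq n] [CommRing R]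
    (M : Matrix n n R) (t : R) :
    ((1 + (Polynomial.X : Polynomial R) • M.map Polynomial.C).det).eval t = (1 + t • M).det := by
  rw [← Polynomial.coe_evalRingHom, RingHom.map_det]
  congr 1
  ext i j
  by_cases hij : i = j <;> simp [hij, mul_comm t]

open Matrix in
lemma Matrix.trace_eq_of_det_one_add_smul_eq {n m K : Type*} [Fintype n] [DecidableEq n] [Fintype m]
    [DecidableEq m] [Field K] (M : Matrix n n K) (M' : Matrix m m K) {s : Set K}
    (hs : s.Infinite) (h : ∀ t ∈ s, (1 + t • M).det = (1 + t • M').det) :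
    M.trace = M'.trace := by
  have : (1 + (Polynomial.X : Polynomial K) • M.map Polynomial.C).det
      = (1 + (Polynomial.X : Polynomial K) • M'.map Polynomial.C).det :=
    Polynomial.eq_of_infinite_eval_eq _ _ (hs.mono fun t ht => by
      rw [Set.mem_ofPred_eq, eval_det_one_add_X_smul, eval_det_one_add_X_smul, h t ht])
  rw [← coeff_det_one_add_X_smul_one, this, coeff_det_one_add_X_smul_one]

-- Difference of squares: (1 + rM)(1 - rM) = 1 - r²M².
open Matrix in
lemma Matrix.det_one_add_neg_mul_self_smul {n R : Type*} [Fintype n] [DecidableEq n] [CommRing R]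
    (M : Matrix n n R) (r : R) :
    (1 + (-(r * r)) • (M * M)).det = (1 + r • M).det * (1 + (-r) • M).det := by
  rw [← det_mul]
  congr 1
  simp only [mul_add, add_mul, one_mul, mul_one, smul_mul_smul_comm]
  rw [mul_neg]
  module

open Matrix in
/-- If `det (1 + t M) = det (1 + t M')` for all `t`, then `M ^ 2` and `M' ^ 2` have the same
trace. -/
lemma Matrix.trace_mul_self_eq_of_det_one_add_smul_eq {n m : Type*} [Fintype n] [DecidableEq n]
    [Fintype m] [DecidableEq m] (M : Matrix n n ℝ) (M' : Matrix m m ℝ)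
    (h : ∀ t : ℝ, (1 + t • M).det = (1 + t • M').det) :
    (M * M).trace = (M' * M').trace := by
  -- Only t ≤ 0 has the form -r² over the reals; infinitely many values suffice.
  refine trace_eq_of_det_one_add_smul_eq _ _ (Set.Iic_infinite (0 : ℝ)) fun t ht => ?_
  obtain ⟨r, rfl⟩ : ∃ r : ℝ, t = - (r * r) :=
    ⟨√(-t), by rw [Real.mul_self_sqrt (by simpa using ht)]; ring⟩
  rw [det_one_add_neg_mul_self_smul, det_one_add_neg_mul_self_smul, h, h]

open Matrix in
lemma Matrix.diagonal_add_smul_eq {n K : Type*} [Fintype n] [DecidableEq n] [Field K] (f : n → K)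
    (t : K) (B : Matrix n n K) (hf : ∀ i, f i ≠ 0) :
    diagonal f + t • B = diagonal f * (1 + t • (diagonal (fun i => (f i)⁻¹) * B)) := by
  ext i j
  by_cases hij : i = j
  · subst hij; have := hf i; simp; field_simp
  · have := hf i; simp [hij]; field_simp

/-! ### Invariants of the A_α-spectrum: pencil, degrees, connectedness, weighted edge count. -/

namespace SimpleGraph

variable {V W : Type*} [Fintype V] [Fintype W] {G : SimpleGraph V} {H : SimpleGraph W}

lemma aAlphaMatrix_isHermitian (G : SimpleGraph V) (α : ℝ) : (G.aAlphaMatrix α).IsHermitian := by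
  classical
  unfold aAlphaMatrix
  exact ((G.isHermitian_degMatrix (R := ℝ)).smul (IsSelfAdjoint.all α)).add
    ((G.isHermitian_adjMatrix (R := ℝ)).smul (IsSelfAdjoint.all (1 - α)))

lemma AAlphaCospectral.aAlphaCharpoly_eq (h : G.AAlphaCospectral H) {α : ℝ}
    (hα : α ∈ Set.Icc (0 : ℝ) 1) : G.aAlphaCharpoly α = H.aAlphaCharpoly α := by
  classical
  have hr := h α hα
  unfold aAlphaSpectrum at hr
  unfold aAlphaCharpoly at hr ⊢
  rw [(G.aAlphaMatrix_isHermitian α).splits_charpoly.eq_prod_roots_of_monic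
      (Matrix.charpoly_monic _), hr,
    ← (H.aAlphaMatrix_isHermitian α).splits_charpoly.eq_prod_roots_of_monic
      (Matrix.charpoly_monic _)]

lemma AAlphaCospectral.card_eq (h : G.AAlphaCospectral H) : Fintype.card V = Fintype.card W := by
  classical
  have := congrArg Polynomial.natDegree (h.aAlphaCharpoly_eq (α := 0) (by simp))
  unfold aAlphaCharpoly at this
  rwa [Matrix.charpoly_natDegree_eq_dim, Matrix.charpoly_natDegree_eq_dim] at this

open scoped Classical in
lemma eval_aAlphaCharpoly_mul (F : SimpleGraph V) (x : ℝ) {a t : ℝ} (hat : 1 - a = a * t) :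
    (F.aAlphaCharpoly a).eval (a * x) = a ^ Fintype.card V *
      (Matrix.diagonal (fun v => x - F.degree v) + t • (-F.adjMatrix ℝ)).det := by
  rw [aAlphaCharpoly, Matrix.eval_charpoly, ← Matrix.det_smul, aAlphaMatrix, hat]
  congr 1
  ext i j
  by_cases hij : i = j
  · subst hij; simp [degMatrix]; ring
  · simp [degMatrix, hij]

open scoped Classical in
/-- The pencil `x - D - t A` has the same determinant for `A_α`-cospectral graphs, for all
real `x` and `t`. -/
lemma AAlphaCospectral.det_eq (h : G.AAlphaCospectral H) (x t : ℝ) :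
    (Matrix.diagonal (fun v => x - G.degree v) + t • (-G.adjMatrix ℝ)).det
      = (Matrix.diagonal (fun v => x - H.degree v) + t • (-H.adjMatrix ℝ)).det := by
  refine Matrix.det_add_smul_eq_of_infinite _ _ _ _ (Set.Ici_infinite (0 : ℝ)) (fun t ht => ?_) t
  have ht : (0 : ℝ) ≤ t := ht
  -- The solution of 1 - a = a t; it lies in (0, 1] exactly because t ≥ 0.
  set a : ℝ := 1 / (1 + t) with ha
  have ha0 : 0 < a := by positivity
  have ha1 : a ≤ 1 := by rw [ha, div_le_one (by positivity)]; linarith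
  have hat : 1 - a = a * t := by rw [ha]; field_simp; ring
  have h1 := G.eval_aAlphaCharpoly_mul x hat
  rw [h.aAlphaCharpoly_eq ⟨ha0.le, ha1⟩, H.eval_aAlphaCharpoly_mul x hat, h.card_eq] at h1
  exact (mul_left_cancel₀ (by positivity) h1).symm

open scoped Classical in
lemma aAlphaSpectrum_one (F : SimpleGraph V) :
    F.aAlphaSpectrum 1 = (Finset.univ.val.map fun v => F.degree v).map (Nat.cast : ℕ → ℝ) := by
  rw [aAlphaSpectrum, aAlphaCharpoly, aAlphaMatrix, degMatrix, one_smul, sub_self, zero_smul,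
    add_zero, Matrix.charpoly_diagonal, Multiset.map_map]
  have := Polynomial.roots_multiset_prod_X_sub_C
    (Finset.univ.val.map fun v => (F.degree v : ℝ))
  rw [Multiset.map_map] at this
  exact this

open scoped Classical in
lemma AAlphaCospectral.map_degree_eq (h : G.AAlphaCospectral H) :
    Finset.univ.val.map (fun v => G.degree v) = Finset.univ.val.map (fun v => H.degree v) := by
  have h1 := h 1 (by simp)
  rw [aAlphaSpectrum_one, aAlphaSpectrum_one] at h1
  exact Multiset.map_injective Nat.cast_injective h1

open scoped Classical in
lemma AAlphaCospectral.exists_equiv_degree_eq (h : G.AAlphaCospectral H) :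
    ∃ e : V ≃ W, ∀ v, H.degree (e v) = G.degree v := by
  have key : ∀ c : ℕ, Nonempty ({v // G.degree v = c} ≃ {w // H.degree w = c}) := by
    intro c
    rw [← Fintype.card_eq, Fintype.card_subtype, Fintype.card_subtype]
    have := congrArg (Multiset.count c) h.map_degree_eq
    rw [Multiset.count_map, Multiset.count_map] at this
    simpa [Finset.card_def, eq_comm] using this
  let e := fun c => (key c).some
  exact ⟨Equiv.ofFiberEquiv e, fun v => Equiv.ofFiberEquiv_map e v⟩

lemma AAlphaCospectral.connected (h : G.AAlphaCospectral H) (hG : G.Connected) :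
    H.Connected := by
  classical
  have hL : (G.lapMatrix ℝ).charpoly = (H.lapMatrix ℝ).charpoly := by
    refine Polynomial.funext fun x => ?_
    rw [Matrix.eval_charpoly, Matrix.eval_charpoly]
    -- At t = -1 the pencil is x - D + A = x - L.
    convert h.det_eq x (-1) using 2
    · ext i j
      by_cases hij : i = j
      · subst hij; simp [degMatrix, lapMatrix]
      · simp [degMatrix, lapMatrix, hij]
    · ext i j
      by_cases hij : i = j
      · subst hij; simp [degMatrix, lapMatrix]
      · simp [degMatrix, lapMatrix, hij]
  have hrank : (G.lapMatrix ℝ).rank = (H.lapMatrix ℝ).rank := by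
    have hG' := G.isHermitian_lapMatrix (R := ℝ)
    have hH' := H.isHermitian_lapMatrix (R := ℝ)
    rw [hG'.rank_eq_card_non_zero_eigs, hH'.rank_eq_card_non_zero_eigs, Fintype.card_subtype,
      Fintype.card_subtype]
    have := hG'.roots_charpoly_eq_eigenvalues.symm.trans
      ((congrArg Polynomial.roots hL).trans hH'.roots_charpoly_eq_eigenvalues)
    have := congrArg (Multiset.countP (· ≠ 0)) this
    rw [Multiset.countP_map, Multiset.countP_map] at this
    simpa [Finset.card_def] using this
  -- The nullity of the Laplacian counts connected components.
  have hker : Fintype.card G.ConnectedComponent = Fintype.card H.ConnectedComponent := by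
    have h1 := LinearMap.finrank_range_add_finrank_ker (Matrix.toLin' (G.lapMatrix ℝ))
    have h2 := LinearMap.finrank_range_add_finrank_ker (Matrix.toLin' (H.lapMatrix ℝ))
    rw [← card_connectedComponent_eq_finrank_ker_toLin'_lapMatrix] at h1 h2
    change Module.finrank ℝ (Matrix.toLin' (G.lapMatrix ℝ)).range
      = Module.finrank ℝ (Matrix.toLin' (H.lapMatrix ℝ)).range at hrank
    rw [Module.finrank_fintype_fun_eq_card] at h1 h2
    have := h.card_eq
    omega
  have := hG.preconnected.subsingleton_connectedComponent
  have := hG.nonempty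
  have : Nonempty G.ConnectedComponent := ⟨G.connectedComponentMk hG.nonempty.some⟩
  have h1 : Fintype.card H.ConnectedComponent = 1 := by
    rw [← hker]; exact le_antisymm (Fintype.card_le_one_iff_subsingleton.2 inferInstance)
      Fintype.card_pos
  obtain ⟨c, hc⟩ := Fintype.card_eq_one_iff.1 h1
  obtain ⟨w, rfl⟩ := c.exists_rep
  exact (H.connected_iff_exists_forall_reachable).2 ⟨w, fun w' =>
    (ConnectedComponent.exact (hc (H.connectedComponentMk w'))).symm⟩

open scoped Classical in
lemma trace_inv_mul_adjMatrix_mul_self (F : SimpleGraph V) (f : V → ℝ) :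
    ((Matrix.diagonal f * (-F.adjMatrix ℝ)) * (Matrix.diagonal f * (-F.adjMatrix ℝ))).trace
      = ∑ u, ∑ v, if F.Adj u v then f u * f v else 0 := by
  simp only [Matrix.trace, Matrix.diag, Matrix.mul_apply (M := _ * _), Matrix.diagonal_mul]
  refine Finset.sum_congr rfl fun u _ => Finset.sum_congr rfl fun v _ => ?_
  by_cases huv : F.Adj u v
  · simp [huv, huv.symm]
  · simp [huv]

open scoped Classical in
/-- Away from the degrees, the quadratic coefficient of the pencil `x - D - t A` gives a weighted
edge count. -/
lemma AAlphaCospectral.sum_adj_inv_mul_inv_eq (h : G.AAlphaCospectral H) (x : ℝ)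
    (hG : ∀ v, x - G.degree v ≠ 0) (hH : ∀ v, x - H.degree v ≠ 0) :
    (∑ u, ∑ v, if G.Adj u v then (x - G.degree u)⁻¹ * (x - G.degree v)⁻¹ else 0)
      = ∑ u, ∑ v, if H.Adj u v then (x - H.degree u)⁻¹ * (x - H.degree v)⁻¹ else 0 := by
  rw [← G.trace_inv_mul_adjMatrix_mul_self fun v => (x - G.degree v)⁻¹,
    ← H.trace_inv_mul_adjMatrix_mul_self fun v => (x - H.degree v)⁻¹]
  refine Matrix.trace_mul_self_eq_of_det_one_add_smul_eq _ _ fun t => ?_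
  have h0 := h.det_eq x 0
  have ht := h.det_eq x t
  -- At t = 0 this equates the products of the x - d_v, which can then be cancelled from the pencil
  -- identity.
  rw [zero_smul, zero_smul, add_zero, add_zero] at h0
  have hne : (Matrix.diagonal (fun v => x - (H.degree v : ℝ))).det ≠ 0 := by
    rw [Matrix.det_diagonal]
    exact Finset.prod_ne_zero_iff.2 fun v _ => hH v
  rw [Matrix.diagonal_add_smul_eq _ _ _ hG, Matrix.diagonal_add_smul_eq _ _ _ hH, Matrix.det_mul, Matrix.det_mul,
    h0] at ht
  exact mul_left_cancel₀ hne ht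

end SimpleGraph

/-! ### Leaf counts, and the residue of the edge count at x = 1. -/

namespace SimpleGraph

variable {V W : Type*} [Fintype V] [Fintype W] {G : SimpleGraph V} {H : SimpleGraph W}

open scoped Classical in
/-- The number of leaves adjacent to a vertex. -/
noncomputable def leafDegree (G : SimpleGraph V) (v : V) : ℕ :=
  Finset.card {u | G.Adj u v ∧ G.degree u = 1}

open scoped Classical in
lemma leafDegree_eq_sum {R : Type*} [Semiring R] (G : SimpleGraph V) (v : V) :
    (G.leafDegree v : R) = ∑ u, if G.Adj u v ∧ G.degree u = 1 then 1 else 0 := by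
  rw [leafDegree, Finset.card_filter]
  push_cast
  rfl

open scoped Classical in
lemma sum_leafDegree (G : SimpleGraph V) :
    ∑ v, G.leafDegree v = Finset.card {u | G.degree u = 1} := by
  have h1 : ∀ v, G.leafDegree v = ∑ u, if G.Adj u v ∧ G.degree u = 1 then 1 else 0 :=
    G.leafDegree_eq_sum (R := ℕ)
  simp_rw [h1]
  rw [Finset.sum_comm, Finset.card_filter]
  refine Finset.sum_congr rfl fun u _ => ?_
  by_cases hu : G.degree u = 1
  · simp only [hu, and_true, if_true]
    rw [← G.degree_eq_sum_if_adj (R := ℕ) u, hu]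
    rfl
  · simp [hu]

open scoped Classical Topology in
/-- The residue at `1` of the weighted edge count `∑ 1 / ((x - d_u) (x - d_v))`. -/
lemma tendsto_sum_adj_inv_mul_inv (G : SimpleGraph V)
    (hG : ∀ u v, G.Adj u v → G.degree u = 1 → G.degree v ≠ 1) :
    Filter.Tendsto (fun x : ℝ => (x - 1) *
      ∑ u, ∑ v, if G.Adj u v then (x - G.degree u)⁻¹ * (x - G.degree v)⁻¹ else 0) (𝓝[≠] 1)
      (𝓝 (2 * ∑ v, G.leafDegree v * (1 - (G.degree v : ℝ))⁻¹)) := by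
  have hlim : 2 * ∑ v, G.leafDegree v * (1 - (G.degree v : ℝ))⁻¹
      = ∑ u, ∑ v, if G.Adj u v then
        ((if G.degree u = 1 then (1 - (G.degree v : ℝ))⁻¹ else 0) +
          if G.degree v = 1 then (1 - (G.degree u : ℝ))⁻¹ else 0) else 0 := by
    have h1 : ∑ v, G.leafDegree v * (1 - (G.degree v : ℝ))⁻¹ =
        ∑ v, ∑ u, if G.Adj u v then
          (if G.degree u = 1 then (1 - (G.degree v : ℝ))⁻¹ else 0) else 0 := by
      refine Finset.sum_congr rfl fun v _ => ?_
      rw [G.leafDegree_eq_sum, Finset.sum_mul]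
      refine Finset.sum_congr rfl fun u _ => ?_
      by_cases h : G.Adj u v <;> by_cases h' : G.degree u = 1 <;> simp [h, h']
    rw [two_mul]
    nth_rewrite 1 [h1.trans Finset.sum_comm]
    rw [h1, ← Finset.sum_add_distrib]
    refine Finset.sum_congr rfl fun u _ => ?_
    rw [← Finset.sum_add_distrib]
    refine Finset.sum_congr rfl fun v _ => ?_
    by_cases h : G.Adj u v
    · simp [h, h.symm]
    · simp [h, G.adj_comm v u]
  rw [hlim]
  simp_rw [Finset.mul_sum]
  refine tendsto_finsetSum _ fun u _ => tendsto_finsetSum _ fun v _ => ?_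
  by_cases huv : G.Adj u v
  swap
  · simp [huv]
  simp only [huv, if_true]
  have hid : Filter.Tendsto (fun x : ℝ => x) (𝓝[≠] 1) (𝓝 1) :=
    Filter.tendsto_id.mono_left nhdsWithin_le_nhds
  have hinv : ∀ d : ℕ, d ≠ 1 →
      Filter.Tendsto (fun x : ℝ => (x - d)⁻¹) (𝓝[≠] 1) (𝓝 (1 - (d : ℝ))⁻¹) := fun d hd =>
    (hid.sub_const _).inv₀ (sub_ne_zero.2 (by exact_mod_cast hd.symm))
  -- An edge with exactly one leaf end has a simple pole at 1, cancelled by x - 1; an edge with none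
  -- tends to 0. Two leaf ends would give a double pole, which `hG` excludes.
  by_cases hu : G.degree u = 1
  · have hv := hG u v huv hu
    simp only [hu, hv, if_true, if_false, add_zero]
    refine (hinv _ hv).congr' ?_
    filter_upwards [self_mem_nhdsWithin] with x hx
    have : x - 1 ≠ 0 := sub_ne_zero.2 hx
    push_cast
    field_simp
  · by_cases hv : G.degree v = 1
    · simp only [hu, hv, if_true, if_false, zero_add]
      refine (hinv _ hu).congr' ?_
      filter_upwards [self_mem_nhdsWithin] with x hx
      have : x - 1 ≠ 0 := sub_ne_zero.2 hx
      push_cast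
      field_simp
    · simp only [hu, hv, if_false, zero_add]
      have := (hid.sub_const 1).mul ((hinv _ hu).mul (hinv _ hv))
      simpa using this

open scoped Classical Topology in
lemma eventually_sub_degree_ne_zero (G : SimpleGraph V) :
    ∀ᶠ x : ℝ in 𝓝[≠] 1, ∀ v, x - G.degree v ≠ 0 := by
  rw [Filter.eventually_all]
  intro v
  by_cases hv : G.degree v = 1
  · filter_upwards [self_mem_nhdsWithin] with x hx
    simpa [hv, sub_eq_zero] using hx
  · have : (1 : ℝ) ≠ G.degree v := by exact_mod_cast Ne.symm hv
    filter_upwards [nhdsWithin_le_nhds (isOpen_ne.mem_nhds this)] with x hx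
    exact sub_ne_zero.2 hx

open scoped Classical Topology in
lemma AAlphaCospectral.sum_leafDegree_mul_inv_eq (h : G.AAlphaCospectral H)
    (hG : ∀ u v, G.Adj u v → G.degree u = 1 → G.degree v ≠ 1)
    (hH : ∀ u v, H.Adj u v → H.degree u = 1 → H.degree v ≠ 1) :
    ∑ v, G.leafDegree v * (1 - (G.degree v : ℝ))⁻¹
      = ∑ v, H.leafDegree v * (1 - (H.degree v : ℝ))⁻¹ := by
  have h1 := G.tendsto_sum_adj_inv_mul_inv hG
  have h2 := H.tendsto_sum_adj_inv_mul_inv hH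
  refine mul_left_cancel₀ two_ne_zero (tendsto_nhds_unique (h1.congr' ?_) h2)
  filter_upwards [G.eventually_sub_degree_ne_zero, H.eventually_sub_degree_ne_zero] with x hx hx'
  rw [h.sum_adj_inv_mul_inv_eq x hx hx']

open scoped Classical in
lemma Walk.IsPath.two_le_degree_getVert {u v : V} {w : G.Walk u v} (hw : w.IsPath) {i : ℕ}
    (hi : i + 1 < w.length) : 2 ≤ G.degree (w.getVert (i + 1)) := by
  have hne : w.getVert i ≠ w.getVert (i + 2) := fun h => by
    have := hw.getVert_injOn (show i ≤ w.length by omega) (show i + 2 ≤ w.length by omega) h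
    omega
  rw [← card_neighborFinset_eq_degree, ← Finset.card_pair hne]
  refine Finset.card_le_card fun x hx => ?_
  rw [mem_neighborFinset]
  rcases Finset.mem_insert.1 hx with rfl | hx
  · exact (w.adj_getVert_succ (by omega)).symm
  · rw [Finset.mem_singleton.1 hx]
    exact w.adj_getVert_succ hi

open scoped Classical in
lemma Connected.exists_adj_two_le_degree (hG : G.Connected) {x w : V} (hxw : x ≠ w)
    (hw : 2 ≤ G.degree w) : ∃ y, G.Adj x y ∧ 2 ≤ G.degree y := by
  obtain ⟨P, hP⟩ := hG.exists_isPath x w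
  have hl : P.length ≠ 0 := fun h => hxw (Walk.eq_of_length_eq_zero h)
  refine ⟨P.getVert 1, by simpa using P.adj_getVert_succ (i := 0) (by omega), ?_⟩
  by_cases h1 : P.length = 1
  · rw [← h1, P.getVert_length]
    exact hw
  · exact hP.two_le_degree_getVert (i := 0) (by omega)

-- A path from x to whichever of w₁, w₂ differs from x starts with a nonleaf neighbour.
open scoped Classical in
lemma Connected.leafDegree_lt (hG : G.Connected) {w₁ w₂ : V} (hw : w₁ ≠ w₂)
    (h₁ : 2 ≤ G.degree w₁) (h₂ : 2 ≤ G.degree w₂) (x : V) : G.leafDegree x < G.degree x := by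
  obtain ⟨y, hxy, hy⟩ : ∃ y, G.Adj x y ∧ 2 ≤ G.degree y := by
    by_cases hx : x = w₁
    · exact hG.exists_adj_two_le_degree (hx ▸ hw) h₂
    · exact hG.exists_adj_two_le_degree hx h₁
  rw [leafDegree, ← card_neighborFinset_eq_degree]
  refine Finset.card_lt_card ⟨fun u hu => ?_, fun hs => ?_⟩
  · rw [mem_neighborFinset]
    exact (Finset.mem_filter.1 hu).2.1.symm
  · have := (Finset.mem_filter.1 (hs ((mem_neighborFinset _ _ _).2 hxy))).2.2
    omega

open scoped Classical in
lemma degree_ne_one_of_leafDegree_lt (h : ∀ x, G.leafDegree x < G.degree x) (u v : V)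
    (huv : G.Adj u v) (hu : G.degree u = 1) : G.degree v ≠ 1 := by
  intro hv
  have h1 := h v
  rw [hv, Nat.lt_one_iff, leafDegree, Finset.card_eq_zero] at h1
  have : u ∈ ({u | G.Adj u v ∧ G.degree u = 1} : Finset V) := by simp [huv, hu]
  rw [h1] at this
  simp at this

-- Termwise, (d - 2)(1 - l/(d - 1)) = (d - 2) - l - l/(1 - d), and the l(v) sum to the number of
-- leaves. Every sum on the right is a spectral invariant, hence so is the left side.
open scoped Classical in
lemma sum_sub_two_mul_one_sub_leafDegree (h : ∀ x, G.leafDegree x < G.degree x) :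
    (∑ v, if 2 ≤ G.degree v then
        ((G.degree v : ℝ) - 2) * (1 - G.leafDegree v / (G.degree v - 1)) else 0)
      = (∑ v, if 2 ≤ G.degree v then (G.degree v : ℝ) - 2 else 0)
        - (∑ v, if G.degree v = 1 then (1 : ℝ) else 0)
        - ∑ v, G.leafDegree v * (1 - (G.degree v : ℝ))⁻¹ := by
  have hs : (∑ v, if G.degree v = 1 then (1 : ℝ) else 0) = ∑ v, (G.leafDegree v : ℝ) := by
    have := congrArg (Nat.cast : ℕ → ℝ) G.sum_leafDegree
    rw [Finset.card_filter] at this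
    push_cast at this
    exact this.symm
  rw [hs, ← Finset.sum_sub_distrib, ← Finset.sum_sub_distrib]
  refine Finset.sum_congr rfl fun v _ => ?_
  have hv := h v
  by_cases h2 : 2 ≤ G.degree v
  · have h2' : (2 : ℝ) ≤ G.degree v := by exact_mod_cast h2
    have ha : (G.degree v : ℝ) - 1 ≠ 0 := by linarith
    have hb : 1 - (G.degree v : ℝ) = -((G.degree v : ℝ) - 1) := by ring
    simp only [h2, if_true]
    rw [hb, inv_neg]
    field_simp
    ring
  · have : G.leafDegree v = 0 := by omega
    simp [h2, this]

open scoped Classical in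
/-- In connected `A_α`-cospectral graphs with two nonleaves, if every vertex of degree at least `3`
of one has exactly one neighbour that is not a leaf, then so does the other. -/
lemma AAlphaCospectral.leafDegree_add_one_eq (h : G.AAlphaCospectral H)
    (hG : ∀ x, G.leafDegree x < G.degree x) (hH : ∀ x, H.leafDegree x < H.degree x)
    (h3 : ∀ x, 3 ≤ G.degree x → G.leafDegree x + 1 = G.degree x) (x : W)
    (hx : 3 ≤ H.degree x) : H.leafDegree x + 1 = H.degree x := by
  obtain ⟨e, he⟩ := h.exists_equiv_degree_eq
  have hzero : (∑ v, if 2 ≤ H.degree v then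
        ((H.degree v : ℝ) - 2) * (1 - H.leafDegree v / (H.degree v - 1)) else 0) = 0 := by
    rw [sum_sub_two_mul_one_sub_leafDegree hH,
      ← h.sum_leafDegree_mul_inv_eq (degree_ne_one_of_leafDegree_lt hG)
        (degree_ne_one_of_leafDegree_lt hH), ← e.sum_comp, ← e.sum_comp]
    simp only [he]
    rw [← sum_sub_two_mul_one_sub_leafDegree hG]
    refine Finset.sum_eq_zero fun v _ => ?_
    by_cases hv3 : 3 ≤ G.degree v
    · have h1 := h3 v hv3
      have h3' : (3 : ℝ) ≤ G.degree v := by exact_mod_cast hv3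
      have h1' : (G.leafDegree v : ℝ) = G.degree v - 1 := by
        rw [← h1]; push_cast; ring
      rw [h1', div_self (by linarith)]
      simp
    -- The factor d - 2 kills degree 2, so such vertices may have any number of nonleaf neighbours.
    · by_cases hv2 : G.degree v = 2
      · simp [hv2]
      · rw [if_neg (by omega)]
  have hx3 : (3 : ℝ) ≤ H.degree x := by exact_mod_cast hx
  -- Nonnegativity of the terms comes from l(v) ≤ d_v - 1, that is, from `hH`.
  have hterm := (Finset.sum_eq_zero_iff_of_nonneg fun v _ => ?_).1 hzero x (Finset.mem_univ x)
  · rw [if_pos (by omega)] at hterm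
    rcases mul_eq_zero.1 hterm with h0 | h0
    · linarith
    · have h1 : (H.leafDegree x : ℝ) / (H.degree x - 1) = 1 := by linarith
      rw [div_eq_one_iff_eq (by linarith)] at h1
      have : ((H.leafDegree x + 1 : ℕ) : ℝ) = H.degree x := by push_cast; linarith
      exact_mod_cast this
  · split_ifs with hv
    · have hv' : (2 : ℝ) ≤ H.degree v := by exact_mod_cast hv
      have hl : (H.leafDegree v : ℝ) + 1 ≤ H.degree v := by exact_mod_cast hH v
      have : (H.leafDegree v : ℝ) / (H.degree v - 1) ≤ 1 := by
        rw [div_le_one (by linarith)]; linarith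
      exact mul_nonneg (by linarith) (by linarith)
    · exact le_rfl

open scoped Classical in
/-- An injective homomorphism into a connected graph that does not increase degrees is an
isomorphism. -/
lemma Connected.nonempty_iso_of_injective (hH : H.Connected) [Nonempty V] (f : G →g H)
    (hf : Function.Injective f) (hdeg : ∀ x, H.degree (f x) ≤ G.degree x) :
    Nonempty (G ≃g H) := by
  have hnb : ∀ x y, H.Adj (f x) y → ∃ x', G.Adj x x' ∧ f x' = y := by
    intro x y hxy
    have hsub : (G.neighborFinset x).map ⟨f, hf⟩ ⊆ H.neighborFinset (f x) := by
      intro z hz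
      obtain ⟨x', hx', rfl⟩ := Finset.mem_map.1 hz
      exact (mem_neighborFinset _ _ _).2 (f.map_adj ((mem_neighborFinset _ _ _).1 hx'))
    -- The degree bound forces the image of the neighbourhood of x to be the whole neighbourhood of
    -- f x, so the range of f is closed under walks.
    have heq := Finset.eq_of_subset_of_card_le hsub (by simpa using hdeg x)
    have hy : y ∈ (G.neighborFinset x).map ⟨f, hf⟩ := by
      rw [heq]; exact (mem_neighborFinset _ _ _).2 hxy
    obtain ⟨x', hx', h⟩ := Finset.mem_map.1 hy
    exact ⟨x', (mem_neighborFinset _ _ _).1 hx', h⟩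
  have hwalk : ∀ {y z : W} (_ : H.Walk y z), y ∈ Set.range f → z ∈ Set.range f := by
    intro y z P
    induction P with
    | nil => exact id
    | cons hadj _ ih =>
      rintro ⟨x, rfl⟩
      obtain ⟨x', -, rfl⟩ := hnb x _ hadj
      exact ih ⟨x', rfl⟩
  have hsurj : Function.Surjective f := fun z => by
    obtain ⟨x⟩ := ‹Nonempty V›
    exact hwalk (hH.preconnected (f x) z).some ⟨x, rfl⟩
  refine ⟨⟨Equiv.ofBijective f ⟨hf, hsurj⟩, fun {x y} => ⟨fun h => ?_, fun h => f.map_adj h⟩⟩⟩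
  obtain ⟨x', hx', h'⟩ := hnb x _ h
  exact hf h' ▸ hx'

end SimpleGraph

/-! ### Degrees and leaves of H(p,n,q), and its structural characterization. -/

open scoped Classical in
lemma SimpleGraph.degree_pathGraph {n : ℕ} (hn : 2 ≤ n) (i : Fin n) :
    (SimpleGraph.pathGraph n).degree i = if i.val = 0 ∨ i.val + 1 = n then 1 else 2 := by
  rw [← SimpleGraph.card_neighborFinset_eq_degree]
  split_ifs with h
  · rw [Finset.card_eq_one]
    rcases h with h | h
    · refine ⟨⟨1, by omega⟩, ?_⟩
      ext j
      simp [SimpleGraph.pathGraph_adj, Fin.ext_iff]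
      omega
    · refine ⟨⟨i.val - 1, by omega⟩, ?_⟩
      ext j
      simp [SimpleGraph.pathGraph_adj, Fin.ext_iff]
      omega
  · rw [Finset.card_eq_two]
    refine ⟨⟨i.val - 1, by omega⟩, ⟨i.val + 1, by omega⟩, by simp [Fin.ext_iff], ?_⟩
    ext j
    simp [SimpleGraph.pathGraph_adj, Fin.ext_iff]
    omega

namespace doubleStarlikeTree

variable {p n q : ℕ}

lemma adj_inl_inl (i j : Fin n) : (doubleStarlikeTree p n q).Adj (.inl i) (.inl j) ↔
    (SimpleGraph.pathGraph n).Adj i j := Iff.rfl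

lemma adj_inl_inr_inl (i : Fin n) (j : Fin p) :
    (doubleStarlikeTree p n q).Adj (.inl i) (.inr (.inl j)) ↔ i.val = 0 := Iff.rfl

lemma adj_inl_inr_inr (i : Fin n) (j : Fin q) :
    (doubleStarlikeTree p n q).Adj (.inl i) (.inr (.inr j)) ↔ i.val + 1 = n := Iff.rfl

lemma not_adj_inr_inr (i j : Fin p ⊕ Fin q) :
    ¬ (doubleStarlikeTree p n q).Adj (.inr i) (.inr j) := by
  rcases i with i | i <;> rcases j with j | j <;> exact id

open scoped Classical in
lemma degree_inl (hn : 2 ≤ n) (i : Fin n) :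
    (doubleStarlikeTree p n q).degree (.inl i) =
      if i.val = 0 then p + 1 else if i.val + 1 = n then q + 1 else 2 := by
  have h := (doubleStarlikeTree p n q).degree_eq_sum_if_adj (R := ℕ) (.inl i)
  have h' := (SimpleGraph.pathGraph n).degree_eq_sum_if_adj (R := ℕ) i
  rw [SimpleGraph.degree_pathGraph hn] at h'
  simp only [Nat.cast_id] at h h'
  rw [h, Fintype.sum_sum_type, Fintype.sum_sum_type]
  simp only [adj_inl_inl, adj_inl_inr_inl, adj_inl_inr_inr]
  rw [← h']
  by_cases h0 : i.val = 0
  · simp [h0, show ¬ (1 = n) by omega]; omega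
  · by_cases h1 : i.val + 1 = n
    · simp [h0, h1]; omega
    · simp [h0, h1]

open scoped Classical in
lemma degree_inr (hn : 2 ≤ n) (i : Fin p ⊕ Fin q) :
    (doubleStarlikeTree p n q).degree (.inr i) = 1 := by
  rw [← SimpleGraph.card_neighborFinset_eq_degree, Finset.card_eq_one]
  rcases i with i | i
  · refine ⟨.inl ⟨0, by omega⟩, ?_⟩
    ext (j | j)
    · rw [SimpleGraph.mem_neighborFinset, SimpleGraph.adj_comm, adj_inl_inr_inl]
      simp [Fin.ext_iff]
    · simp [not_adj_inr_inr]
  · refine ⟨.inl ⟨n - 1, by omega⟩, ?_⟩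
    ext (j | j)
    · rw [SimpleGraph.mem_neighborFinset, SimpleGraph.adj_comm, adj_inl_inr_inr]
      simp [Fin.ext_iff]
      omega
    · simp [not_adj_inr_inr]

lemma connected (hn : 2 ≤ n) : (doubleStarlikeTree p n q).Connected := by
  rw [SimpleGraph.connected_iff_exists_forall_reachable]
  let f : SimpleGraph.pathGraph n →g doubleStarlikeTree p n q := ⟨Sum.inl, fun h => h⟩
  have hpath : ∀ i, (doubleStarlikeTree p n q).Reachable (.inl ⟨0, by omega⟩) (.inl i) := fun i =>
    (SimpleGraph.pathGraph_preconnected n ⟨0, by omega⟩ i).map f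
  refine ⟨.inl ⟨0, by omega⟩, ?_⟩
  rintro (i | i | i)
  · exact hpath i
  · exact (show (doubleStarlikeTree p n q).Adj (.inl ⟨0, by omega⟩) (.inr (.inl i)) from
      rfl).reachable
  · refine (hpath ⟨n - 1, by omega⟩).trans
      (show (doubleStarlikeTree p n q).Adj (.inl ⟨n - 1, by omega⟩) (.inr (.inr i)) from
        ?_).reachable
    change n - 1 + 1 = n
    omega

open scoped Classical in
lemma leafDegree_lt (hp : 2 ≤ p) (hn : 2 ≤ n) (hq : 2 ≤ q)
    (x : Fin n ⊕ (Fin p ⊕ Fin q)) :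
    (doubleStarlikeTree p n q).leafDegree x < (doubleStarlikeTree p n q).degree x := by
  refine (connected hn).leafDegree_lt (w₁ := .inl ⟨0, by omega⟩) (w₂ := .inl ⟨n - 1, by omega⟩)
    ?_ ?_ ?_ x
  · simp [Fin.ext_iff]; omega
  · rw [degree_inl hn, if_pos rfl]; omega
  · rw [degree_inl hn]; split_ifs <;> omega

open scoped Classical in
lemma leafDegree_add_one_eq (hp : 2 ≤ p) (hn : 2 ≤ n) (hq : 2 ≤ q)
    (x : Fin n ⊕ (Fin p ⊕ Fin q)) (hx : 3 ≤ (doubleStarlikeTree p n q).degree x) :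
    (doubleStarlikeTree p n q).leafDegree x + 1 = (doubleStarlikeTree p n q).degree x := by
  have hlt := leafDegree_lt hp hn hq x
  refine le_antisymm hlt ?_
  rcases x with i | i
  swap
  · rw [degree_inr hn] at hx; omega
  rw [degree_inl hn] at hx ⊢
  split_ifs at hx ⊢ with h0 h1
  · refine Nat.succ_le_succ ?_
    rw [SimpleGraph.leafDegree]
    calc p = (Finset.univ.map (Function.Embedding.inl.trans Function.Embedding.inr :
            Fin p ↪ Fin n ⊕ (Fin p ⊕ Fin q))).card := by simp
      _ ≤ _ := Finset.card_le_card fun y hy => by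
        obtain ⟨j, -, rfl⟩ := Finset.mem_map.1 hy
        exact Finset.mem_filter.2 ⟨Finset.mem_univ _, h0, degree_inr hn _⟩
  · refine Nat.succ_le_succ ?_
    rw [SimpleGraph.leafDegree]
    calc q = (Finset.univ.map (Function.Embedding.inr.trans Function.Embedding.inr :
            Fin q ↪ Fin n ⊕ (Fin p ⊕ Fin q))).card := by simp
      _ ≤ _ := Finset.card_le_card fun y hy => by
        obtain ⟨j, -, rfl⟩ := Finset.mem_map.1 hy
        exact Finset.mem_filter.2 ⟨Finset.mem_univ _, h1, degree_inr hn _⟩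
  · omega

open scoped Classical in
/-- A connected graph with two vertices `u`, `v` of degrees at least `2`, all but one of whose
neighbours are leaves, and all other vertices of degree at most `2`, is a double starlike tree. -/
lemma exists_iso_of_connected {W : Type*} [Fintype W] {G : SimpleGraph W} (hG : G.Connected)
    {u v : W} (huv : u ≠ v) (hp : 1 ≤ p) (hq : 1 ≤ q) (hu : G.degree u = p + 1)
    (hv : G.degree v = q + 1) (hlu : G.leafDegree u = p) (hlv : G.leafDegree v = q)
    (h2 : ∀ x, x ≠ u → x ≠ v → G.degree x ≤ 2) :
    ∃ m, Nonempty (doubleStarlikeTree p m q ≃g G) := by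
  obtain ⟨P, hP⟩ := hG.exists_isPath u v
  have hl : P.length ≠ 0 := fun h => huv (SimpleGraph.Walk.eq_of_length_eq_zero h)
  have hinj := hP.getVert_injOn
  obtain ⟨a⟩ : Nonempty (Fin p ≃ {x // G.Adj x u ∧ G.degree x = 1}) := by
    rw [← Fintype.card_eq, Fintype.card_fin, Fintype.card_subtype]
    exact hlu.symm
  obtain ⟨b⟩ : Nonempty (Fin q ≃ {x // G.Adj x v ∧ G.degree x = 1}) := by
    rw [← Fintype.card_eq, Fintype.card_fin, Fintype.card_subtype]
    exact hlv.symm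
  have hcore : ∀ i, i ≤ P.length → 2 ≤ G.degree (P.getVert i) := by
    intro i hi
    rcases i with _ | i
    · rw [P.getVert_zero]; omega
    · rcases hi.lt_or_eq with h | h
      · exact hP.two_le_degree_getVert h
      · rw [h, P.getVert_length]; omega
  -- This keeps the leaves at u distinct from those at v; `hcore` keeps both off the path.
  have hleaf : ∀ x, G.degree x = 1 → ∀ y z, G.Adj x y → G.Adj x z → y = z := by
    intro x hx y z hy hz
    rw [← SimpleGraph.card_neighborFinset_eq_degree] at hx
    exact Finset.card_le_one.1 hx.le y ((SimpleGraph.mem_neighborFinset _ _ _).2 hy) z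
      ((SimpleGraph.mem_neighborFinset _ _ _).2 hz)
  let φ : Fin (P.length + 1) ⊕ (Fin p ⊕ Fin q) → W :=
    Sum.elim (fun i => P.getVert i) (Sum.elim (fun j => (a j).1) (fun j => (b j).1))
  have hend : ∀ i : Fin (P.length + 1), i.val + 1 = P.length + 1 → P.getVert i = v := fun i hi => by
    rw [Nat.succ_injective hi, P.getVert_length]
  have hstart : ∀ i : Fin (P.length + 1), i.val = 0 → P.getVert i = u := fun i hi => by
    rw [hi, P.getVert_zero]
  have hpath : ∀ i j : Fin (P.length + 1), (SimpleGraph.pathGraph _).Adj i j →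
      G.Adj (P.getVert i) (P.getVert j) := by
    intro i j hij
    rw [SimpleGraph.pathGraph_adj] at hij
    rcases hij with h | h
    · rw [← h]; exact P.adj_getVert_succ (by omega)
    · rw [← h]; exact (P.adj_getVert_succ (by omega)).symm
  let f : doubleStarlikeTree p (P.length + 1) q →g G := ⟨φ, by
    rintro (i | i | i) (j | j | j) h
    · exact hpath i j h
    · change G.Adj (P.getVert i) (a j).1
      rw [hstart i h]; exact (a j).2.1.symm
    · change G.Adj (P.getVert i) (b j).1
      rw [hend i h]; exact (b j).2.1.symm
    · change G.Adj (a i).1 (P.getVert j)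
      rw [hstart j h]; exact (a i).2.1
    · exact h.elim
    · exact h.elim
    · change G.Adj (b i).1 (P.getVert j)
      rw [hend j h]; exact (b i).2.1
    · exact h.elim
    · exact h.elim⟩
  refine ⟨P.length + 1, hG.nonempty_iso_of_injective f ?_ ?_⟩
  · refine Function.Injective.sumElim (fun i j h => Fin.ext (hinj ?_ ?_ h))
      (Function.Injective.sumElim (Subtype.val_injective.comp a.injective)
        (Subtype.val_injective.comp b.injective) fun i j h => ?_) ?_
    · exact Nat.le_of_lt_succ i.2
    · exact Nat.le_of_lt_succ j.2
    · exact huv (hleaf _ (a i).2.2 _ _ (a i).2.1 (h ▸ (b j).2.1))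
    · rintro i (j | j) h
      · have h1 := hcore i (Nat.le_of_lt_succ i.2)
        have h2 : P.getVert i = (a j).1 := h
        rw [h2, (a j).2.2] at h1
        omega
      · have h1 := hcore i (Nat.le_of_lt_succ i.2)
        have h2 : P.getVert i = (b j).1 := h
        rw [h2, (b j).2.2] at h1
        omega
  · rintro (i | i | i)
    · change G.degree (P.getVert i) ≤ _
      rw [degree_inl (by omega)]
      split_ifs with h0 h1
      · rw [hstart i h0, hu]
      · rw [hend i h1, hv]
      -- The path meets u and v only at its ends, so its interior vertices have degree at most 2.
      · refine h2 _ (fun h => h0 ?_) fun h => h1 ?_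
        · exact (hP.getVert_eq_start_iff (Nat.le_of_lt_succ i.2)).1 h
        · rw [(hP.getVert_eq_end_iff (Nat.le_of_lt_succ i.2)).1 h]
    · rw [degree_inr (by omega)]
      exact (a i).2.2.le
    · rw [degree_inr (by omega)]
      exact (b i).2.2.le

end doubleStarlikeTree

/-! ### Conclusion. -/

theorem corollary4p5 (p n q : ℕ) (hp : 2 ≤ p) (hn : 2 ≤ n) (hq : 2 ≤ q) :
    (doubleStarlikeTree p n q).IsDeterminedByAAlphaSpectrum := by
  classical
  intro W _ G h
  have hconn : G.Connected := h.connected (doubleStarlikeTree.connected hn)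
  obtain ⟨e, he⟩ := h.exists_equiv_degree_eq
  set u : Fin n ⊕ (Fin p ⊕ Fin q) := .inl ⟨0, by omega⟩ with hu_def
  set v : Fin n ⊕ (Fin p ⊕ Fin q) := .inl ⟨n - 1, by omega⟩ with hv_def
  have huv : u ≠ v := by simp [hu_def, hv_def, Fin.ext_iff]; omega
  have hu : G.degree (e u) = p + 1 := by
    rw [he, hu_def, doubleStarlikeTree.degree_inl hn, if_pos rfl]
  have hv : G.degree (e v) = q + 1 := by
    rw [he, hv_def, doubleStarlikeTree.degree_inl hn, if_neg (by simp; omega),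
      if_pos (by simp; omega)]
  have hlt := hconn.leafDegree_lt (e.injective.ne huv) (by omega) (by omega)
  have hleaf := h.leafDegree_add_one_eq (doubleStarlikeTree.leafDegree_lt hp hn hq) hlt
    (doubleStarlikeTree.leafDegree_add_one_eq hp hn hq)
  have hlu := hleaf (e u) (by omega)
  have hlv := hleaf (e v) (by omega)
  obtain ⟨m, ⟨i⟩⟩ := doubleStarlikeTree.exists_iso_of_connected hconn (e.injective.ne huv)
    (show 1 ≤ p by omega) (show 1 ≤ q by omega) hu hv (by omega) (by omega) fun x hxu hxv => by
      obtain ⟨y, rfl⟩ := e.surjective x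
      rw [he]
      rcases y with y | y
      · rw [doubleStarlikeTree.degree_inl hn, if_neg, if_neg]
        · exact fun h' => hxv (congrArg e (congrArg Sum.inl (Fin.ext (by simp; omega))))
        · exact fun h' => hxu (congrArg e (congrArg Sum.inl (Fin.ext h')))
      · rw [doubleStarlikeTree.degree_inr hn]; omega
  -- The length m of the path is fixed by the number of vertices.
  have hcard := (Fintype.card_congr i.toEquiv).trans h.card_eq.symm
  simp only [Fintype.card_sum, Fintype.card_fin] at hcard
  obtain rfl : m = n := by omega
  exact ⟨i⟩
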